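/- Let $d>0$, let $\Omega=\mathbb{R}\times(0,d)$, and for $\lambda>0$ let $\mathcal{D}(\lambda)\subset\partial\Omega$ be either $$\text{(A)}\quad \mathcal{D}(\lambda)=\{(x,0): x<-\lambda d\}\cup\{(x,d): x>\lambda d\}$$ or $$\text{(B)}\quad \mathcal{D}(\lambda)=\{(x,d): x<-\lambda d \text{ or } x>\lambda d\}.$$ Let $Q(\lambda)=\{f\in H^1(\Omega): f\upharpoonright\mathcal{D}(\lambda)=0\}$, where $H^1(\Omega)$ is the Sobolev space of complex-valued functions in $L^2(\Omega)$ with distributional gradient in $L^2(\Omega)$, and $f\upharpoonright\mathcal{D}(\lambda)$ is the trace of $f$ on $\mathcal{D}(\lambda)$. For $n=1,2,\ldots$ define the min-max values (in the extended real line) $$\mu_n(\lambda)=\sup_{\varphi_1,\ldots,\varphi_{n-1}\in L^2(\Omega)}\ \inf_{\substack{\psi\in Q(\lambda),\ \psi\neq0\\ \psi\perp\varphi_1,\ldots,\varphi_{n-1}}}\frac{\|\nabla\psi\|^2_{L^2(\Omega)}}{\|\psi\|^2_{L^2(\Omega)}}.$$ Then, in each of the cases (A) and (B) and for every $n=1,2,\ldots$,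 the function $\lambda\mapsto\mu_n(\lambda)$ is nonincreasing, finite and continuous on $(0,\infty)$. -/

import Mathlib

open MeasureTheory Set Filter Topology
open scoped ContDiff

noncomputable section

namespace Waveguide

/-- The straight strip `Ω = ℝ × (0, d)`. -/
def strip (d : ℝ) : Set (ℝ × ℝ) := univ ×ˢ Ioo 0 d

/-- The complex Hilbert space `L²(Ω)`. -/
abbrev L2 (d : ℝ) : Type := Lp ℂ 2 (volume.restrict (strip d))

/-- `g` is the distributional derivative of `f` on `Ω` in the direction `v`:
`∫_Ω f ∂ᵥφ = - ∫_Ω g φ` for all `φ ∈ C_c^∞(Ω)`. -/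
def HasWeakDeriv (d : ℝ) (v : ℝ × ℝ) (f g : L2 d) : Prop :=
  ∀ φ : ℝ × ℝ → ℂ, ContDiff ℝ ∞ φ → HasCompactSupport φ → tsupport φ ⊆ strip d →
    ∫ p in strip d, f p * fderiv ℝ φ p v = - ∫ p in strip d, g p * φ p

/-- An element of the Sobolev space `H¹(Ω)`: a function of `L²(Ω)` together with its
distributional partial derivatives (which it determines), both in `L²(Ω)`. -/
structure H1 (d : ℝ) where
  /-- the function -/
  toL2 : L2 d
  /-- its derivative in `x` -/
  dx : L2 d
  /-- its derivative in `y` -/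
  dy : L2 d
  hasWeakDeriv_dx : HasWeakDeriv d (1, 0) toL2 dx
  hasWeakDeriv_dy : HasWeakDeriv d (0, 1) toL2 dy

/-- `g ∈ L²(ℝ)` is the trace of `f ∈ H¹(Ω)` on the boundary line `y = b` (where `b = 0` or `b = d`),
that is, the value at `f` of the continuous extension to `H¹(Ω)` of the restriction map
`φ ↦ φ(·, b)`, given on the dense set of restrictions to `Ω` of functions of `C_c^∞(ℝ²)`. -/
def HasTrace (d b : ℝ) (f : H1 d) (g : Lp ℂ 2 (volume : Measure ℝ)) : Prop :=
  ∃ φ : ℕ → ℝ × ℝ → ℂ,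
    (∀ k, ContDiff ℝ ∞ (φ k) ∧ HasCompactSupport (φ k)) ∧
    Tendsto (fun k => eLpNorm (fun p => φ k p - f.toL2 p) 2 (volume.restrict (strip d)))
      atTop (𝓝 0) ∧
    Tendsto (fun k => eLpNorm (fun p => fderiv ℝ (φ k) p (1, 0) - f.dx p) 2
      (volume.restrict (strip d))) atTop (𝓝 0) ∧
    Tendsto (fun k => eLpNorm (fun p => fderiv ℝ (φ k) p (0, 1) - f.dy p) 2
      (volume.restrict (strip d))) atTop (𝓝 0) ∧
    Tendsto (fun k => eLpNorm (fun x => φ k (x, b) - g x) 2 volume) atTop (𝓝 0)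

/-- The trace of `f` vanishes almost everywhere on the part `𝒟` of `∂Ω`. -/
def TraceVanishesOn (d : ℝ) (𝒟 : Set (ℝ × ℝ)) (f : H1 d) : Prop :=
  ∀ b : ℝ, b = 0 ∨ b = d → ∃ g : Lp ℂ 2 (volume : Measure ℝ),
    HasTrace d b f g ∧ ∀ᵐ x, (x, b) ∈ 𝒟 → g x = 0

/-- The two arrangements of the boundary conditions. -/
inductive Model : Type
  | A
  | B

/-- The part `𝒟(l)` of the boundary of `Ω` that carries the Dirichlet condition. -/
def dirichletPart (d : ℝ) : Model → ℝ → Set (ℝ × ℝ)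
  | .A, l => {p | p.2 = 0 ∧ p.1 < -(l * d)} ∪ {p | p.2 = d ∧ l * d < p.1}
  | .B, l => {p | p.2 = d ∧ (p.1 < -(l * d) ∨ l * d < p.1)}

/-- The form domain `Q(l)`. -/
def formDomain (d : ℝ) (M : Model) (l : ℝ) : Set (H1 d) :=
  {f | TraceVanishesOn d (dirichletPart d M l) f}

/-- `‖∇ψ‖² / ‖ψ‖²`, with norms in `L²(Ω)`. -/
def rayleigh {d : ℝ} (ψ : H1 d) : ℝ :=
  (‖ψ.dx‖ ^ 2 + ‖ψ.dy‖ ^ 2) / ‖ψ.toL2‖ ^ 2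

/-- `U(φ₁, …, φₘ; l)`, an infimum in the extended real line. -/
def U (d : ℝ) (M : Model) {m : ℕ} (φ : Fin m → L2 d) (l : ℝ) : EReal :=
  ⨅ (ψ : H1 d) (_ : ψ ∈ formDomain d M l) (_ : ψ.toL2 ≠ 0)
    (_ : ∀ i, inner ℂ (φ i) ψ.toL2 = 0), (rayleigh ψ : EReal)

/-- The min-max value `μₙ(l)`, `n = 1, 2, …`, a supremum in the extended real line. -/
def mu (d : ℝ) (M : Model) (n : ℕ) (l : ℝ) : EReal :=
  ⨆ φ : Fin (n - 1) → L2 d, U d M φ l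

end Waveguide

end

/-! Enlarging λ shrinks the Dirichlet part, so `Q(λ)` grows and the min-max values fall
(`mu_antitone`). They cannot fall fast: for `u ≥ 1`, composing `ψ ∈ Q(uλ)` with `(x, y) ↦ (u x, y)`
gives an element of `Q(λ)`. The Jacobian cancels in the Rayleigh quotient, and only the
`x`-derivative is amplified, so the quotient grows at most by `u²`. Orthogonality constraints are
carried over by the inverse dilation. Hence `μₙ(uλ) ≤ μₙ(λ) ≤ u² μₙ(uλ)` (`mu_le_mul_mu`), and
letting `u → 1` gives continuity.

Finiteness is separate (`mu_ne_top`): the form domain contains `n` bumps with disjoint supports, and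
`n - 1` constraints cannot annihilate their whole span. -/

noncomputable section

namespace Waveguide

/-! ### Dilations in `x` acting on `L²(Ω)` -/

/-- The stretching `(x, y) ↦ (u x, y)` of the plane. -/
def stretch (u : ℝˣ) : (ℝ × ℝ) ≃L[ℝ] (ℝ × ℝ) :=
  (ContinuousLinearEquiv.smulLeft u).prodCongr (ContinuousLinearEquiv.refl ℝ ℝ)

@[simp] lemma stretch_apply (u : ℝˣ) (p : ℝ × ℝ) : stretch u p = ((u : ℝ) * p.1, p.2) := rfl

lemma stretch_inv_stretch (u : ℝˣ) (p : ℝ × ℝ) : stretch u⁻¹ (stretch u p) = p := by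
  simp

lemma measurableEmbedding_stretch (u : ℝˣ) : MeasurableEmbedding (stretch u) :=
  (stretch u).toHomeomorph.measurableEmbedding

lemma stretch_mem_strip {d : ℝ} (u : ℝˣ) {p : ℝ × ℝ} : stretch u p ∈ strip d ↔ p ∈ strip d := by
  simp [strip]

lemma map_mul_volume (u : ℝˣ) :
    Measure.map (fun x : ℝ => (u : ℝ) * x) volume = ENNReal.ofReal |(u : ℝ)⁻¹| • volume :=
  Real.map_volume_mul_left u.ne_zero

lemma map_stretch_strip (d : ℝ) (u : ℝˣ) :
    Measure.map (stretch u) (volume.restrict (strip d)) =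
      ENNReal.ofReal |(u : ℝ)⁻¹| • volume.restrict (strip d) := by
  have h1 : (volume.restrict (strip d) : Measure (ℝ × ℝ)) =
      (volume : Measure ℝ).prod ((volume : Measure ℝ).restrict (Ioo 0 d)) := by
    rw [strip, Measure.volume_eq_prod, ← Measure.prod_restrict, Measure.restrict_univ]
  have h2 : (stretch u : ℝ × ℝ → ℝ × ℝ) = Prod.map (fun x => (u : ℝ) * x) id := rfl
  rw [h1, h2, ← Measure.map_prod_map _ _ (by fun_prop) measurable_id, map_mul_volume,
    Measure.map_id, Measure.prod_smul_left]

lemma quasiMeasurePreserving_stretch (d : ℝ) (u : ℝˣ) :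
    Measure.QuasiMeasurePreserving (stretch u) (volume.restrict (strip d))
      (volume.restrict (strip d)) :=
  ⟨(measurableEmbedding_stretch u).measurable, by
    rw [map_stretch_strip]; exact Measure.smul_absolutelyContinuous⟩

/-- The factor by which a stretching changes `L²` norms. -/
def stretchFactor (u : ℝˣ) : ENNReal := ENNReal.ofReal |(u : ℝ)⁻¹| ^ (1 / 2 : ℝ)

lemma stretchFactor_ne_top (u : ℝˣ) : stretchFactor u ≠ ⊤ :=
  ENNReal.rpow_ne_top_of_nonneg (by norm_num) ENNReal.ofReal_ne_top

lemma stretchFactor_ne_zero (u : ℝˣ) : stretchFactor u ≠ 0 := by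
  have : 0 < |(u : ℝ)⁻¹| := abs_pos.2 (inv_ne_zero u.ne_zero)
  exact (ENNReal.rpow_pos (ENNReal.ofReal_pos.2 this) ENNReal.ofReal_ne_top).ne'

lemma eLpNorm_comp_stretch (d : ℝ) (u : ℝˣ) (F : ℝ × ℝ → ℂ) :
    eLpNorm (fun p => F (stretch u p)) 2 (volume.restrict (strip d)) =
      stretchFactor u * eLpNorm F 2 (volume.restrict (strip d)) := by
  have := (measurableEmbedding_stretch u).eLpNorm_map_measure (g := F) (p := 2)
    (μ := volume.restrict (strip d))
  rw [map_stretch_strip, eLpNorm_smul_measure_of_ne_top (by simp)] at this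
  simpa [stretchFactor, Function.comp_def] using this.symm

lemma eLpNorm_comp_mul (u : ℝˣ) (F : ℝ → ℂ) :
    eLpNorm (fun x => F (u * x)) 2 volume = stretchFactor u * eLpNorm F 2 volume := by
  have := (Homeomorph.mulLeft₀ (u : ℝ) u.ne_zero).measurableEmbedding.eLpNorm_map_measure
    (g := F) (p := 2) (μ := volume)
  have h2 : (Homeomorph.mulLeft₀ (u : ℝ) u.ne_zero : ℝ → ℝ) = fun x => (u : ℝ) * x := rfl
  rw [h2, map_mul_volume, eLpNorm_smul_measure_of_ne_top (by simp)] at this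
  simpa [stretchFactor, Function.comp_def] using this.symm

lemma integral_comp_stretch (d : ℝ) (u : ℝˣ) (F : ℝ × ℝ → ℂ) :
    ∫ p in strip d, F (stretch u p) = ((|(u : ℝ)⁻¹| : ℝ) : ℂ) * ∫ p in strip d, F p := by
  have := (measurableEmbedding_stretch u).integral_map (μ := volume.restrict (strip d)) F
  rw [map_stretch_strip, integral_smul_measure, ENNReal.toReal_ofReal (abs_nonneg _)] at this
  rw [← this, Complex.real_smul]

lemma memLp_comp_stretch {d : ℝ} (u : ℝˣ) (f : L2 d) :
    MemLp (fun p => f (stretch u p)) 2 (volume.restrict (strip d)) :=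
  ⟨(Lp.aestronglyMeasurable f).comp_quasiMeasurePreserving (quasiMeasurePreserving_stretch d u), by
    rw [eLpNorm_comp_stretch]
    exact ENNReal.mul_lt_top (stretchFactor_ne_top u).lt_top (Lp.eLpNorm_lt_top f)⟩

/-- Composition of an element of `L²(Ω)` with a stretching. -/
def stretchL2 {d : ℝ} (u : ℝˣ) (f : L2 d) : L2 d := (memLp_comp_stretch u f).toLp

lemma coeFn_stretchL2 {d : ℝ} (u : ℝˣ) (f : L2 d) :
    stretchL2 u f =ᵐ[volume.restrict (strip d)] fun p => f (stretch u p) :=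
  MemLp.coeFn_toLp _

lemma norm_stretchL2 {d : ℝ} (u : ℝˣ) (f : L2 d) :
    ‖stretchL2 u f‖ = (stretchFactor u).toReal * ‖f‖ := by
  rw [stretchL2, Lp.norm_toLp, eLpNorm_comp_stretch, ENNReal.toReal_mul, Lp.norm_def]

/-- Up to the Jacobian, the adjoint of a dilation is the inverse dilation. This moves orthogonality
constraints from one parameter to another. -/
lemma inner_stretchL2 {d : ℝ} (u : ℝˣ) (φ f : L2 d) :
    inner ℂ φ (stretchL2 u f) = ((|(u : ℝ)⁻¹| : ℝ) : ℂ) * inner ℂ (stretchL2 u⁻¹ φ) f := by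
  have h : ∫ p in strip d, inner ℂ (φ p) (stretchL2 u f p) =
      ∫ p in strip d, inner ℂ (φ (stretch u⁻¹ (stretch u p))) (f (stretch u p)) := by
    refine integral_congr_ae ?_
    filter_upwards [coeFn_stretchL2 u f] with p hp
    rw [hp, stretch_inv_stretch]
  rw [L2.inner_def, h, integral_comp_stretch d u (fun p => inner ℂ (φ (stretch u⁻¹ p)) (f p)),
    L2.inner_def]
  congr 1
  refine integral_congr_ae ?_
  filter_upwards [coeFn_stretchL2 u⁻¹ φ] with p hp
  rw [hp]

/-! ### Dilations acting on weak derivatives and traces -/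

lemma fderiv_comp_stretch (u : ℝˣ) {χ : ℝ × ℝ → ℂ} (hχ : ContDiff ℝ ∞ χ) (p v : ℝ × ℝ) :
    fderiv ℝ (fun q => χ (stretch u q)) p v = fderiv ℝ χ (stretch u p) (stretch u v) := by
  have h := ((hχ.differentiable (by simp)) (stretch u p)).hasFDerivAt.comp p
    (stretch u).hasFDerivAt
  have h2 : fderiv ℝ (fun q => χ (stretch u q)) p = _ := h.fderiv
  rw [h2]; rfl

lemma contDiff_comp_stretch (u : ℝˣ) {χ : ℝ × ℝ → ℂ} (hχ : ContDiff ℝ ∞ χ) :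
    ContDiff ℝ ∞ (fun q => χ (stretch u q)) := hχ.comp (stretch u).contDiff

lemma hasCompactSupport_comp_stretch (u : ℝˣ) {χ : ℝ × ℝ → ℂ} (hχ : HasCompactSupport χ) :
    HasCompactSupport (fun q => χ (stretch u q)) := hχ.comp_homeomorph (stretch u).toHomeomorph

lemma HasWeakDeriv.smul {d : ℝ} {v : ℝ × ℝ} {f g : L2 d} (h : HasWeakDeriv d v f g) (c : ℝ) :
    HasWeakDeriv d (c • v) f ((c : ℂ) • g) := by
  intro φ h1 h2 h3
  have e : ∫ p in strip d, ((c : ℂ) • g : L2 d) p * φ p = c * ∫ p in strip d, g p * φ p := by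
    rw [← integral_const_mul]
    refine integral_congr_ae ?_
    filter_upwards [Lp.coeFn_smul (c : ℂ) g] with p hp
    rw [hp, Pi.smul_apply, smul_eq_mul, mul_assoc]
  rw [e, ← mul_neg, ← h φ h1 h2 h3, ← integral_const_mul]
  congr 1 with p
  rw [map_smul, Complex.real_smul]; ring

/-- Test against `φ ∘ stretch u⁻¹`: the chain rule turns the direction `v` into `stretch u v`, and
both sides acquire the same Jacobian. -/
lemma HasWeakDeriv.comp_stretch {d : ℝ} (u : ℝˣ) {v : ℝ × ℝ} {f g : L2 d}
    (h : HasWeakDeriv d (stretch u v) f g) :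
    HasWeakDeriv d v (stretchL2 u f) (stretchL2 u g) := by
  intro φ h1 h2 h3
  set χ : ℝ × ℝ → ℂ := fun q => φ (stretch u⁻¹ q) with hχ
  have c1 : ContDiff ℝ ∞ χ := contDiff_comp_stretch _ h1
  have hφ : φ = fun p => χ (stretch u p) := by
    ext p; simp only [hχ, stretch_inv_stretch]
  have c3 : tsupport χ ⊆ strip d := by
    have := tsupport_comp_eq_preimage φ (stretch u⁻¹).toHomeomorph
    have e : tsupport χ = stretch u⁻¹ ⁻¹' tsupport φ := this
    rw [e]
    intro p hp
    exact (stretch_mem_strip u⁻¹).1 (h3 hp)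
  have key := h χ c1 (hasCompactSupport_comp_stretch _ h2) c3
  have e1 : ∫ p in strip d, stretchL2 u f p * fderiv ℝ φ p v =
      ∫ p in strip d, f (stretch u p) * fderiv ℝ χ (stretch u p) (stretch u v) := by
    refine integral_congr_ae ?_
    filter_upwards [coeFn_stretchL2 u f] with p hp
    rw [hp, ← fderiv_comp_stretch u c1, ← hφ]
  have e2 : ∫ p in strip d, stretchL2 u g p * φ p =
      ∫ p in strip d, g (stretch u p) * χ (stretch u p) := by
    refine integral_congr_ae ?_
    filter_upwards [coeFn_stretchL2 u g] with p hp
    rw [hp, hφ]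
  rw [e1, e2, integral_comp_stretch d u (fun p => f p * fderiv ℝ χ p (stretch u v)),
    integral_comp_stretch d u (fun p => g p * χ p), key, mul_neg]

lemma stretch_basis_fst (u : ℝˣ) : stretch u (1, 0) = (u : ℝ) • ((1, 0) : ℝ × ℝ) := by simp

lemma stretch_basis_snd (u : ℝˣ) : stretch u (0, 1) = (0, 1) := by simp

/-- Composition of an element of `H¹(Ω)` with a stretching. -/
def stretchH1 {d : ℝ} (u : ℝˣ) (f : H1 d) : H1 d where
  toL2 := stretchL2 u f.toL2
  dx := stretchL2 u ((u : ℝ) • f.dx)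
  dy := stretchL2 u f.dy
  hasWeakDeriv_dx := by
    refine HasWeakDeriv.comp_stretch u ?_
    rw [stretch_basis_fst]
    exact f.hasWeakDeriv_dx.smul u
  hasWeakDeriv_dy := by
    refine HasWeakDeriv.comp_stretch u ?_
    rw [stretch_basis_snd]
    exact f.hasWeakDeriv_dy

lemma memLp_comp_mul (u : ℝˣ) (g : Lp ℂ 2 (volume : Measure ℝ)) :
    MemLp (fun x => g (u * x)) 2 volume := by
  refine ⟨(Lp.aestronglyMeasurable g).comp_quasiMeasurePreserving ⟨by fun_prop, ?_⟩, ?_⟩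
  · rw [map_mul_volume]; exact Measure.smul_absolutelyContinuous
  · rw [eLpNorm_comp_mul]
    exact ENNReal.mul_lt_top (stretchFactor_ne_top u).lt_top (Lp.eLpNorm_lt_top g)

lemma tendsto_stretchFactor_mul (u : ℝˣ) {a : ℕ → ENNReal} (h : Tendsto a atTop (𝓝 0)) :
    Tendsto (fun k => stretchFactor u * a k) atTop (𝓝 0) := by
  simpa using ENNReal.Tendsto.const_mul h (Or.inr (stretchFactor_ne_top u))

/-- Dilating the approximating sequence multiplies each error by a fixed finite factor. The Jacobian
on the boundary line equals that on the strip, since `y` is left alone. -/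
lemma HasTrace.comp_stretch {d b : ℝ} (u : ℝˣ) {f : H1 d} {g : Lp ℂ 2 (volume : Measure ℝ)}
    (h : HasTrace d b f g) : HasTrace d b (stretchH1 u f) (memLp_comp_mul u g).toLp := by
  obtain ⟨φ, h1, h2, h3, h4, h5⟩ := h
  refine ⟨fun k p => φ k (stretch u p), fun k => ⟨contDiff_comp_stretch u (h1 k).1,
    hasCompactSupport_comp_stretch u (h1 k).2⟩, ?_, ?_, ?_, ?_⟩
  · refine (tendsto_stretchFactor_mul u h2).congr fun k => ?_
    rw [← eLpNorm_comp_stretch d u]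
    refine eLpNorm_congr_ae ?_
    filter_upwards [coeFn_stretchL2 u f.toL2] with p hp
    simp only [stretchH1]
    rw [hp]
  · have h3' : Tendsto (fun k => ‖(u : ℝ)‖ₑ * eLpNorm (fun p => fderiv ℝ (φ k) p (1, 0) - f.dx p) 2
      (volume.restrict (strip d))) atTop (𝓝 0) := by
      simpa using ENNReal.Tendsto.const_mul h3 (Or.inr enorm_ne_top)
    refine (tendsto_stretchFactor_mul u h3').congr fun k => ?_
    rw [← eLpNorm_const_smul, ← eLpNorm_comp_stretch d u]
    refine eLpNorm_congr_ae ?_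
    filter_upwards [coeFn_stretchL2 u ((u : ℝ) • f.dx),
      (quasiMeasurePreserving_stretch d u).ae (Lp.coeFn_smul (u : ℝ) f.dx)] with p hp hp'
    simp only [stretchH1]
    rw [hp, hp', fderiv_comp_stretch u (h1 k).1, stretch_basis_fst, map_smul, Pi.smul_apply,
      Pi.smul_apply, smul_sub]
  · refine (tendsto_stretchFactor_mul u h4).congr fun k => ?_
    rw [← eLpNorm_comp_stretch d u]
    refine eLpNorm_congr_ae ?_
    filter_upwards [coeFn_stretchL2 u f.dy] with p hp
    simp only [stretchH1]
    rw [hp, fderiv_comp_stretch u (h1 k).1, stretch_basis_snd]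
  · refine (tendsto_stretchFactor_mul u h5).congr fun k => ?_
    rw [← eLpNorm_comp_mul u]
    refine eLpNorm_congr_ae ?_
    filter_upwards [(memLp_comp_mul u g).coeFn_toLp] with x hx
    rw [hx, stretch_apply]

lemma TraceVanishesOn.comp_stretch {d : ℝ} (u : ℝˣ) {𝒟 : Set (ℝ × ℝ)} {f : H1 d}
    (h : TraceVanishesOn d 𝒟 f) : TraceVanishesOn d (stretch u ⁻¹' 𝒟) (stretchH1 u f) := by
  intro b hb
  obtain ⟨g, hg, hg0⟩ := h b hb
  refine ⟨_, hg.comp_stretch u, ?_⟩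
  have q : Measure.QuasiMeasurePreserving (fun x : ℝ => (u : ℝ) * x) volume volume :=
    ⟨by fun_prop, by rw [map_mul_volume]; exact Measure.smul_absolutelyContinuous⟩
  filter_upwards [q.ae hg0, (memLp_comp_mul u g).coeFn_toLp] with x hx hx' hm
  rw [hx']
  exact hx hm

/-! ### Comparison of min-max values at different parameters -/

lemma stretch_preimage_dirichletPart (d : ℝ) (M : Model) (u : ℝˣ) (hu : 0 < (u : ℝ)) (l : ℝ) :
    stretch u ⁻¹' dirichletPart d M (u * l) = dirichletPart d M l := by
  have e1 (x : ℝ) : (u : ℝ) * x < -(u * l * d) ↔ x < -(l * d) := by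
    rw [show -((u : ℝ) * l * d) = u * -(l * d) by ring, mul_lt_mul_iff_right₀ hu]
  have e2 (x : ℝ) : (u : ℝ) * l * d < u * x ↔ l * d < x := by
    rw [mul_assoc, mul_lt_mul_iff_right₀ hu]
  cases M <;> ext p <;> simp [dirichletPart, e1, e2]

lemma stretchH1_mem_formDomain {d : ℝ} {M : Model} (u : ℝˣ) (hu : 0 < (u : ℝ)) {l : ℝ} {f : H1 d}
    (hf : f ∈ formDomain d M (u * l)) : stretchH1 u f ∈ formDomain d M l := by
  have := TraceVanishesOn.comp_stretch u hf
  rwa [stretch_preimage_dirichletPart d M u hu] at this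

lemma rayleigh_nonneg {d : ℝ} (ψ : H1 d) : 0 ≤ rayleigh ψ := by unfold rayleigh; positivity

lemma rayleigh_stretchH1_le {d : ℝ} (u : ℝˣ) (hu : 1 ≤ (u : ℝ)) (f : H1 d) :
    rayleigh (stretchH1 u f) ≤ u ^ 2 * rayleigh f := by
  have hF : 0 < (stretchFactor u).toReal :=
    ENNReal.toReal_pos (stretchFactor_ne_zero u) (stretchFactor_ne_top u)
  simp only [rayleigh, stretchH1, norm_stretchL2, norm_smul, mul_pow, ← mul_add]
  rw [mul_div_mul_left _ _ (by positivity), ← mul_div_assoc, Real.norm_eq_abs, sq_abs]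
  gcongr
  rw [mul_add]
  gcongr
  exact le_mul_of_one_le_left (sq_nonneg _) (one_le_pow₀ hu)

/-- Each competitor for the right-hand infimum, once dilated, competes for the left-hand one. -/
lemma U_le_of_stretch {d : ℝ} (M : Model) {m : ℕ} (φ : Fin m → L2 d) (u : ℝˣ) (hu : 1 ≤ (u : ℝ))
    (l : ℝ) : U d M φ l ≤ ((u ^ 2 : ℝ) : EReal) * U d M (fun i => stretchL2 u⁻¹ (φ i)) (u * l) := by
  have hu0 : 0 < (u : ℝ) := by linarith
  have hc : (0 : EReal) < ((u ^ 2 : ℝ) : EReal) := by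
    exact_mod_cast (by positivity : (0 : ℝ) < u ^ 2)
  -- Dividing by `u²` isolates the infimum, so that `le_iInf` applies; the factor returns for each
  -- `ψ`.
  rw [← EReal.div_le_iff_le_mul hc (EReal.coe_ne_top _)]
  refine le_iInf fun ψ => le_iInf fun hψ => le_iInf fun h0 => le_iInf fun ho => ?_
  rw [EReal.div_le_iff_le_mul hc (EReal.coe_ne_top _)]
  have h0' : (stretchH1 u ψ).toL2 ≠ 0 := by
    rw [← norm_ne_zero_iff]
    change ‖stretchL2 u ψ.toL2‖ ≠ 0
    rw [norm_stretchL2]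
    exact mul_ne_zero (ENNReal.toReal_pos (stretchFactor_ne_zero u) (stretchFactor_ne_top u)).ne'
      (norm_ne_zero_iff.2 h0)
  have ho' : ∀ i, inner ℂ (φ i) (stretchH1 u ψ).toL2 = 0 := fun i => by
    change inner ℂ (φ i) (stretchL2 u ψ.toL2) = 0
    rw [inner_stretchL2, ho i, mul_zero]
  refine (iInf_le_of_le (stretchH1 u ψ) <| iInf_le_of_le (stretchH1_mem_formDomain u hu0 hψ) <|
    iInf_le_of_le h0' <| iInf_le_of_le ho' le_rfl).trans ?_
  exact_mod_cast rayleigh_stretchH1_le u hu ψ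

lemma mu_le_mul_mu (d : ℝ) (M : Model) (n : ℕ) (u : ℝˣ) (hu : 1 ≤ (u : ℝ)) (l : ℝ) :
    mu d M n l ≤ ((u ^ 2 : ℝ) : EReal) * mu d M n (u * l) := by
  refine iSup_le fun φ => (U_le_of_stretch M φ u hu l).trans ?_
  refine mul_le_mul_of_nonneg_left (le_iSup (fun φ => U d M φ (u * l)) _) ?_
  exact_mod_cast (by positivity : (0 : ℝ) ≤ u ^ 2)

lemma dirichletPart_antitone {d : ℝ} (hd : 0 < d) (M : Model) : Antitone (dirichletPart d M) := by
  intro l l' h p hp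
  have := mul_le_mul_of_nonneg_right h hd.le
  cases M
  · rcases hp with hp | hp
    · exact Or.inl ⟨hp.1, by linarith [hp.2]⟩
    · exact Or.inr ⟨hp.1, by linarith [hp.2]⟩
  · exact ⟨hp.1, hp.2.imp (fun h => by linarith) (fun h => by linarith)⟩

lemma formDomain_monotone {d : ℝ} (hd : 0 < d) (M : Model) : Monotone (formDomain d M) := by
  intro l l' h f hf b hb
  obtain ⟨g, hg, hg0⟩ := hf b hb
  exact ⟨g, hg, hg0.mono fun x hx hm => hx (dirichletPart_antitone hd M h hm)⟩

lemma mu_antitone {d : ℝ} (hd : 0 < d) (M : Model) (n : ℕ) : Antitone (mu d M n) := fun _ _ h =>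
  iSup_mono fun _ => iInf_mono fun _ => iInf_mono' fun hψ => ⟨formDomain_monotone hd M h hψ, le_rfl⟩

lemma mu_nonneg (d : ℝ) (M : Model) (n : ℕ) (l : ℝ) : 0 ≤ mu d M n l :=
  le_iSup_of_le 0 <| le_iInf fun ψ => le_iInf fun _ => le_iInf fun _ => le_iInf fun _ => by
    exact_mod_cast rayleigh_nonneg ψ

/-! ### Test functions as elements of the form domain -/

/-- The space `C_c^∞(Ω)` of test functions. -/
def testFunctions (d : ℝ) : Submodule ℂ (ℝ × ℝ → ℂ) where
  carrier := {φ | ContDiff ℝ ∞ φ ∧ HasCompactSupport φ ∧ tsupport φ ⊆ strip d}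
  add_mem' := fun ha hb => ⟨ha.1.add hb.1, ha.2.1.add hb.2.1,
    (tsupport_add _ _).trans (union_subset ha.2.2 hb.2.2)⟩
  zero_mem' := ⟨contDiff_const, HasCompactSupport.zero, by simp [tsupport]⟩
  smul_mem' := fun c φ h => ⟨contDiff_const.smul h.1, h.2.1.smul_left (f := fun _ => c),
    (tsupport_smul_subset_right (fun _ => c) φ).trans h.2.2⟩

section

variable {d : ℝ}

lemma testFunctions.continuous_fderiv (φ : testFunctions d) (v : ℝ × ℝ) :
    Continuous fun p => fderiv ℝ φ.1 p v :=
  (φ.2.1.continuous_fderiv (by simp)).clm_apply continuous_const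

lemma testFunctions.memLp (φ : testFunctions d) : MemLp φ.1 2 (volume.restrict (strip d)) :=
  (φ.2.1.continuous).memLp_of_hasCompactSupport φ.2.2.1

lemma testFunctions.memLp_fderiv (φ : testFunctions d) (v : ℝ × ℝ) :
    MemLp (fun p => fderiv ℝ φ.1 p v) 2 (volume.restrict (strip d)) :=
  (testFunctions.continuous_fderiv φ v).memLp_of_hasCompactSupport (φ.2.2.1.fderiv_apply ℝ v)

/-- The class in `L²(Ω)` of a test function. -/
def testFunctions.toL2 : testFunctions d →ₗ[ℂ] L2 d where
  toFun φ := (testFunctions.memLp φ).toLp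
  map_add' _ _ := rfl
  map_smul' _ _ := rfl

/-- The class in `L²(Ω)` of a directional derivative of a test function. -/
def testFunctions.derivL2 (v : ℝ × ℝ) : testFunctions d →ₗ[ℂ] L2 d where
  toFun φ := (testFunctions.memLp_fderiv φ v).toLp
  map_add' φ χ := by
    rw [← MemLp.toLp_add]
    congr 1
    ext p
    have h1 := (φ.2.1.differentiable (by simp)) p
    have h2 := (χ.2.1.differentiable (by simp)) p
    simp [fderiv_add h1 h2]
  map_smul' c φ := by
    rw [RingHom.id_apply, ← MemLp.toLp_const_smul]
    congr 1
    ext p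
    have h1 := (φ.2.1.differentiable (by simp)) p
    simp [fderiv_const_smul h1]

/-- Both integrands vanish off the strip, so this is integration by parts on the whole plane. -/
lemma testFunctions.hasWeakDeriv (φ : testFunctions d) (v : ℝ × ℝ) :
    HasWeakDeriv d v (testFunctions.toL2 φ) (testFunctions.derivL2 v φ) := by
  intro χ h1 h2 h3
  have z1 : ∀ p ∉ strip d, φ.1 p * fderiv ℝ χ p v = 0 := fun p hp => by
    rw [image_eq_zero_of_notMem_tsupport fun h => hp (φ.2.2.2 h), zero_mul]
  have z2 : ∀ p ∉ strip d, fderiv ℝ φ.1 p v * χ p = 0 := fun p hp => by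
    rw [image_eq_zero_of_notMem_tsupport fun h => hp (h3 h), mul_zero]
  have c1 : Continuous fun p => fderiv ℝ χ p v :=
    (h1.continuous_fderiv (by simp)).clm_apply continuous_const
  have e1 : ∫ p in strip d, testFunctions.toL2 φ p * fderiv ℝ χ p v =
      ∫ p, φ.1 p * fderiv ℝ χ p v := by
    rw [← setIntegral_eq_integral_of_forall_compl_eq_zero z1]
    refine integral_congr_ae ?_
    filter_upwards [(testFunctions.memLp φ).coeFn_toLp] with p hp
    exact congrArg (· * _) hp
  have e2 : ∫ p in strip d, testFunctions.derivL2 v φ p * χ p =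
      ∫ p, fderiv ℝ φ.1 p v * χ p := by
    rw [← setIntegral_eq_integral_of_forall_compl_eq_zero z2]
    refine integral_congr_ae ?_
    filter_upwards [(testFunctions.memLp_fderiv φ v).coeFn_toLp] with p hp
    exact congrArg (· * _) hp
  rw [e1, e2]
  refine integral_mul_fderiv_eq_neg_fderiv_mul_of_integrable ?_ ?_ ?_
    (fun p _ => φ.2.1.differentiable (by simp) p) (fun p _ => h1.differentiable (by simp) p)
  · exact ((testFunctions.continuous_fderiv φ v).mul h1.continuous).integrable_of_hasCompactSupport
      h2.mul_left
  · exact (φ.2.1.continuous.mul c1).integrable_of_hasCompactSupport φ.2.2.1.mul_right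
  · exact (φ.2.1.continuous.mul h1.continuous).integrable_of_hasCompactSupport h2.mul_left

/-- A test function as an element of `H¹(Ω)`. -/
def testFunctions.toH1 (φ : testFunctions d) : H1 d where
  toL2 := testFunctions.toL2 φ
  dx := testFunctions.derivL2 (1, 0) φ
  dy := testFunctions.derivL2 (0, 1) φ
  hasWeakDeriv_dx := testFunctions.hasWeakDeriv φ _
  hasWeakDeriv_dy := testFunctions.hasWeakDeriv φ _

/-- The constant sequence `φ` witnesses a zero trace on both boundary lines. -/
lemma testFunctions.toH1_mem_formDomain (φ : testFunctions d) (M : Model) (l : ℝ) :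
    testFunctions.toH1 φ ∈ formDomain d M l := by
  intro b hb
  have hz : ∀ x : ℝ, φ.1 (x, b) = 0 := fun x => by
    refine image_eq_zero_of_notMem_tsupport fun h => ?_
    have := (φ.2.2.2 h).2
    rcases hb with rfl | rfl
    · exact lt_irrefl _ this.1
    · exact lt_irrefl _ this.2
  have key {F : ℝ × ℝ → ℂ} (hF : MemLp F 2 (volume.restrict (strip d))) :
      eLpNorm (fun p => F p - hF.toLp F p) 2 (volume.restrict (strip d)) = 0 := by
    rw [← eLpNorm_zero (ε := ℂ) (p := 2) (μ := volume.restrict (strip d))]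
    refine eLpNorm_congr_ae ?_
    filter_upwards [hF.coeFn_toLp] with p hp
    simp [hp]
  refine ⟨0, ⟨fun _ => φ.1, fun _ => ⟨φ.2.1, φ.2.2.1⟩, ?_, ?_, ?_, ?_⟩, ?_⟩
  · exact tendsto_const_nhds.congr fun _ => (key (testFunctions.memLp φ)).symm
  · exact tendsto_const_nhds.congr fun _ => (key (testFunctions.memLp_fderiv φ (1, 0))).symm
  · exact tendsto_const_nhds.congr fun _ => (key (testFunctions.memLp_fderiv φ (0, 1))).symm
  · refine tendsto_const_nhds.congr fun _ => ?_
    simp [hz]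
  · simp

/-! ### Disjoint bumps and finiteness -/

/-- A smooth bump around `(k d, d / 2)`. -/
def bump (hd : 0 < d) (k : ℕ) : ContDiffBump ((k * d, d / 2) : ℝ × ℝ) :=
  -- Outer radius `d / 4` keeps the support inside the strip, and is less than half the distance `d`
  -- between neighbouring centres.
  ⟨d / 8, d / 4, by positivity, by linarith⟩

lemma mem_of_mem_closedBall_bump {k : ℕ} {p : ℝ × ℝ}
    (hp : p ∈ Metric.closedBall ((k * d, d / 2) : ℝ × ℝ) (d / 4)) :
    |p.1 - k * d| ≤ d / 4 ∧ |p.2 - d / 2| ≤ d / 4 := by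
  rw [Metric.mem_closedBall, Prod.dist_eq, Real.dist_eq, Real.dist_eq] at hp
  exact ⟨(le_max_left _ _).trans hp, (le_max_right _ _).trans hp⟩

lemma tsupport_ofReal_bump (hd : 0 < d) (k : ℕ) :
    tsupport (fun p => ((bump hd k p : ℝ) : ℂ)) ⊆
      Metric.closedBall ((k * d, d / 2) : ℝ × ℝ) (d / 4) := by
  refine (closure_mono ?_).trans (bump hd k).tsupport_eq.subset
  intro p hp h
  simp [h] at hp

/-- The bump around `(k d, d / 2)` as a complex test function. -/
def bumpTest (hd : 0 < d) (k : ℕ) : testFunctions d :=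
  ⟨fun p => ((bump hd k p : ℝ) : ℂ), Complex.ofRealCLM.contDiff.comp (bump hd k).contDiff,
    (bump hd k).hasCompactSupport.comp_left (g := fun x : ℝ => (x : ℂ)) (by simp),
    (tsupport_ofReal_bump hd k).trans fun p hp => by
      have := abs_le.1 (mem_of_mem_closedBall_bump hp).2
      exact ⟨mem_univ _, by linarith, by linarith⟩⟩

lemma bumpTest_mul_eq_zero (hd : 0 < d) {j k : ℕ} (hjk : j ≠ k) (p : ℝ × ℝ) :
    (bumpTest hd j).1 p = 0 ∨ (bumpTest hd k).1 p = 0 := by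
  by_contra! h
  have h1 := abs_le.1 (mem_of_mem_closedBall_bump
    (tsupport_ofReal_bump hd j (subset_tsupport _ h.1))).1
  have h2 := abs_le.1 (mem_of_mem_closedBall_bump
    (tsupport_ofReal_bump hd k (subset_tsupport _ h.2))).1
  rcases lt_or_gt_of_ne hjk with h | h
  · have : (j : ℝ) + 1 ≤ k := by exact_mod_cast h
    nlinarith
  · have : (k : ℝ) + 1 ≤ j := by exact_mod_cast h
    nlinarith

lemma toL2_bumpTest_ne_zero (hd : 0 < d) (k : ℕ) : testFunctions.toL2 (bumpTest hd k) ≠ 0 := by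
  intro h
  have h1 : (bumpTest hd k).1 =ᵐ[volume.restrict (strip d)] 0 :=
    (MemLp.toLp_eq_toLp_iff (testFunctions.memLp (bumpTest hd k)) MemLp.zero').1 h
  have hs : Metric.ball ((k * d, d / 2) : ℝ × ℝ) (d / 8) ⊆ strip d := fun p hp => by
    have hp' := Metric.ball_subset_closedBall.trans
      (Metric.closedBall_subset_closedBall (by linarith : d / 8 ≤ d / 4)) hp
    have := abs_le.1 (mem_of_mem_closedBall_bump hp').2
    exact ⟨mem_univ _, by linarith, by linarith⟩
  have h2 := ae_mono (Measure.restrict_mono hs le_rfl) h1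
  have h3 : ∀ᵐ p ∂(volume.restrict (Metric.ball ((k * d, d / 2) : ℝ × ℝ) (d / 8))), False := by
    filter_upwards [h2, ae_restrict_mem Metric.isOpen_ball.measurableSet] with p hp hm
    have : bump hd k p = 1 := (bump hd k).one_of_mem_closedBall (Metric.ball_subset_closedBall hm)
    have e : (bumpTest hd k).1 p = ((bump hd k p : ℝ) : ℂ) := rfl
    rw [e, this] at hp
    simp at hp
  rw [ae_iff] at h3
  simp only [not_false_eq_true, ofPred_true, Measure.restrict_apply_univ] at h3
  exact (Metric.measure_ball_pos volume _ (by positivity)).ne' h3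

/-- Disjoint supports make the bumps orthogonal. -/
lemma linearIndependent_toL2_bumpTest (hd : 0 < d) (n : ℕ) :
    LinearIndependent ℂ fun k : Fin n => testFunctions.toL2 (bumpTest hd k) := by
  refine linearIndependent_of_ne_zero_of_inner_eq_zero
    (fun k => toL2_bumpTest_ne_zero hd k) fun j k hjk => ?_
  change inner ℂ (testFunctions.toL2 (bumpTest hd j)) (testFunctions.toL2 (bumpTest hd k)) = 0
  rw [L2.inner_def]
  refine integral_eq_zero_of_ae ?_
  filter_upwards [(testFunctions.memLp (bumpTest hd j)).coeFn_toLp,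
    (testFunctions.memLp (bumpTest hd k)).coeFn_toLp] with p h1 h2
  have e1 : testFunctions.toL2 (bumpTest hd j) p = (bumpTest hd j).1 p := h1
  have e2 : testFunctions.toL2 (bumpTest hd k) p = (bumpTest hd k).1 p := h2
  rw [e1, e2]
  rcases bumpTest_mul_eq_zero hd (fun h => hjk (Fin.ext h)) p with h | h <;> simp [h]

end

/-- On the image of a finite-dimensional space, a linear map is dominated by an injective one. -/
lemma exists_norm_le_mul_of_injective {V E F : Type*} [NormedAddCommGroup V] [NormedSpace ℂ V]
    [FiniteDimensional ℂ V] [NormedAddCommGroup E] [NormedSpace ℂ E] [NormedAddCommGroup F]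
    [NormedSpace ℂ F] (A : V →ₗ[ℂ] E) (hA : Function.Injective A) (B : V →ₗ[ℂ] F) :
    ∃ C : ℝ, ∀ c, ‖B c‖ ≤ C * ‖A c‖ := by
  obtain ⟨K, -, hK⟩ := A.exists_antilipschitzWith (LinearMap.ker_eq_bot.2 hA)
  let B' := LinearMap.toContinuousLinearMap B
  refine ⟨‖B'‖ * K, fun c => ?_⟩
  have h1 : ‖c‖ ≤ K * ‖A c‖ := by simpa using hK.le_mul_dist c 0
  calc ‖B c‖ = ‖B' c‖ := rfl
    _ ≤ ‖B'‖ * ‖c‖ := B'.le_opNorm c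
    _ ≤ ‖B'‖ * (K * ‖A c‖) := by gcongr
    _ = _ := by ring

/-- On the span of `n` bumps the derivatives are bounded by the `L²` norm, with constants chosen
before the constraints `φ`; a nonzero vector of the span meets all `n - 1` constraints. -/
lemma mu_ne_top {d : ℝ} (hd : 0 < d) (M : Model) {n : ℕ} (hn : 1 ≤ n) (l : ℝ) :
    mu d M n l ≠ ⊤ := by
  let S : (Fin n → ℂ) →ₗ[ℂ] testFunctions d := Fintype.linearCombination ℂ fun k => bumpTest hd k
  let A : (Fin n → ℂ) →ₗ[ℂ] L2 d := testFunctions.toL2 ∘ₗ S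
  have hA : Function.Injective A := by
    have e : A = Fintype.linearCombination ℂ fun k : Fin n =>
        testFunctions.toL2 (bumpTest hd k) := by
      ext c; simp [A, S]
    rw [e]
    exact (linearIndependent_toL2_bumpTest hd n).fintypeLinearCombination_injective
  obtain ⟨C₁, h₁⟩ := exists_norm_le_mul_of_injective A hA (testFunctions.derivL2 (1, 0) ∘ₗ S)
  obtain ⟨C₂, h₂⟩ := exists_norm_le_mul_of_injective A hA (testFunctions.derivL2 (0, 1) ∘ₗ S)
  suffices h : mu d M n l ≤ ((C₁ ^ 2 + C₂ ^ 2 : ℝ) : EReal) from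
    (h.trans_lt (EReal.coe_lt_top _)).ne
  refine iSup_le fun φ => ?_
  let P : (Fin n → ℂ) →ₗ[ℂ] (Fin (n - 1) → ℂ) :=
    LinearMap.pi fun i => (innerₛₗ ℂ (φ i)) ∘ₗ A
  have hP : LinearMap.ker P ≠ ⊥ := by
    refine LinearMap.ker_ne_bot_of_finrank_lt ?_
    simp only [Module.finrank_fin_fun]
    -- `n - 1 < n` in truncated subtraction relies on `1 ≤ n`.
    omega
  obtain ⟨c, hc, hc0⟩ := (Submodule.ne_bot_iff _).1 hP
  have hAc : A c ≠ 0 := fun h => hc0 (hA (by rw [h, map_zero]))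
  have hpos : 0 < ‖A c‖ := norm_pos_iff.2 hAc
  refine iInf_le_of_le (testFunctions.toH1 (S c)) <|
    iInf_le_of_le (testFunctions.toH1_mem_formDomain (S c) M l) <|
    iInf_le_of_le hAc <| iInf_le_of_le (fun i => congrFun (LinearMap.mem_ker.1 hc) i) ?_
  have : rayleigh (testFunctions.toH1 (S c)) ≤ C₁ ^ 2 + C₂ ^ 2 := by
    refine (div_le_iff₀ (pow_pos hpos 2)).2 ?_
    have e₁ := pow_le_pow_left₀ (norm_nonneg _) (h₁ c) 2
    have e₂ := pow_le_pow_left₀ (norm_nonneg _) (h₂ c) 2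
    rw [mul_pow] at e₁ e₂
    rw [add_mul]
    exact add_le_add e₁ e₂
  exact_mod_cast this

end Waveguide

/-! ### From the dilation inequality to continuity -/

/-- A nonnegative nonincreasing function on `(0, ∞)` is continuous if it can decrease at most
quadratically under dilations. -/
lemma continuousOn_Ioi_of_antitoneOn_of_le_sq_mul {f : ℝ → ℝ} (hf : AntitoneOn f (Ioi 0))
    (h : ∀ x y, 0 < x → x ≤ y → f x ≤ (y / x) ^ 2 * f y) : ContinuousOn f (Ioi 0) := by
  intro a ha
  have ha' : (0 : ℝ) < a := ha
  refine ContinuousAt.continuousWithinAt ?_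
  have hlim : Tendsto (fun x => (a / x) ^ 2 * f a) (𝓝 a) (𝓝 (f a)) := by
    have : ContinuousAt (fun x => (a / x) ^ 2 * f a) a :=
      ((continuousAt_const.div continuousAt_id ha'.ne').pow 2).mul continuousAt_const
    simpa [ContinuousAt, div_self ha'.ne'] using this
  -- `f x` lies between `f a` and `(a / x)² f a`, in an order that depends on the side of `a`; the
  -- minimum and maximum squeeze it on both sides at once.
  have hmin := hlim.min (tendsto_const_nhds (x := f a))
  have hmax := hlim.max (tendsto_const_nhds (x := f a))
  rw [min_self] at hmin
  rw [max_self] at hmax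
  refine tendsto_of_tendsto_of_tendsto_of_le_of_le' hmin hmax ?_ ?_
  · filter_upwards [Ioi_mem_nhds ha'] with x hx
    have hx' : 0 < x := hx
    rcases le_total x a with hxa | hxa
    · exact (min_le_right _ _).trans (hf hx ha hxa)
    · refine (min_le_left _ _).trans ?_
      calc (a / x) ^ 2 * f a ≤ (a / x) ^ 2 * ((x / a) ^ 2 * f x) := by
            gcongr; exact h a x ha' hxa
        _ = f x := by field_simp
  · filter_upwards [Ioi_mem_nhds ha'] with x hx
    rcases le_total x a with hxa | hxa
    · exact (h x a hx hxa).trans (le_max_left _ _)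
    · exact (hf ha hx hxa).trans (le_max_right _ _)

end

theorem mainTheorem5 (d : ℝ) (hd : 0 < d) (M : Waveguide.Model) (n : ℕ) (hn : 1 ≤ n) :
    AntitoneOn (Waveguide.mu d M n) (Ioi 0) ∧
    (∀ l ∈ Ioi (0 : ℝ), Waveguide.mu d M n l ≠ ⊤ ∧ Waveguide.mu d M n l ≠ ⊥) ∧
    ContinuousOn (fun l => (Waveguide.mu d M n l).toReal) (Ioi 0) := by
  have htop (l : ℝ) : Waveguide.mu d M n l ≠ ⊤ := Waveguide.mu_ne_top hd M hn l
  have hbot (l : ℝ) : Waveguide.mu d M n l ≠ ⊥ :=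
    (EReal.bot_lt_zero.trans_le (Waveguide.mu_nonneg d M n l)).ne'
  have hanti := Waveguide.mu_antitone hd M n
  refine ⟨hanti.antitoneOn _, fun l _ => ⟨htop l, hbot l⟩, ?_⟩
  refine continuousOn_Ioi_of_antitoneOn_of_le_sq_mul
    (fun x _ y _ hxy => EReal.toReal_le_toReal (hanti hxy) (hbot y) (htop x)) fun x y hx hxy => ?_
  have hy : 0 < y := hx.trans_le hxy
  -- The factor `y / x ≥ 1` dilates the parameter `x` to `y`.
  have key := Waveguide.mu_le_mul_mu d M n (Units.mk0 (y / x) (div_pos hy hx).ne')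
    ((one_le_div hx).2 hxy) x
  rw [Units.val_mk0, div_mul_cancel₀ y hx.ne', ← EReal.coe_toReal (htop x) (hbot x),
    ← EReal.coe_toReal (htop y) (hbot y), ← EReal.coe_mul, EReal.coe_le_coe_iff] at key
  exact key
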